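/- Let $[Z]^\omega$ denote the set of infinite subsets of $Z$, and let $$\mathcal I_0=\{A\subseteq\omega\times\omega:\ \forall X,Y\in[\omega]^\omega\ \exists X'\in[X]^\omega\ \exists Y'\in[Y]^\omega\ \ A\cap(X'\times Y')=\emptyset\}.$$ Then: 1. $\mathcal I_0$ is an ideal on $\omega\times\omega$: it contains all finite sets, is closed under subsets and finite unions, and $\omega\times\omega\notin\mathcal I_0$. 2. $\mathcal I_0$ is $\mathbf{\Pi}^1_1$-complete as a subset of $\mathcal P(\omega\times\omega)$, identified with $2^{\omega\times\omega}$ with the product topology: it is coanalytic, and for every coanalytic subset $B$ of a zero-dimensional Polish space $X$ there is a continuous $f:X\to\mathcal P(\omega\times\omega)$ with $f^{-1}(\mathcal I_0)=B$. 3. $\mathcal I_0$ is tall: every infinite $B\subseteq\omega\times\omega$ contains an infinite $A\in\mathcal I_0$. 4. $\mathcal I_0$ is not a P-ideal: it is not the case that for every sequence $(A_n)_{n\in\omega}$ in $\mathcal I_0$ there is $A\in\mathcal I_0$ with $A_n\setminus A$ finite for every $n$. -/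

import Mathlib

/-- `𝓘` is an ideal on the set `α`: it contains all finite subsets of `α`, it is closed under
subsets and under unions of two members, and it is proper. -/
structure IsSetIdeal {α : Type*} (𝓘 : Set (Set α)) : Prop where
  finite_mem : ∀ A : Set α, A.Finite → A ∈ 𝓘
  subset_mem : ∀ A B : Set α, B ∈ 𝓘 → A ⊆ B → A ∈ 𝓘
  union_mem : ∀ A B : Set α, A ∈ 𝓘 → B ∈ 𝓘 → A ∪ B ∈ 𝓘
  univ_notMem : Set.univ ∉ 𝓘

/-- `𝓘` is tall: every infinite subset of `α` contains an infinite element of `𝓘`. -/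
def IsTall {α : Type*} (𝓘 : Set (Set α)) : Prop :=
  ∀ B : Set α, B.Infinite → ∃ A ∈ 𝓘, A ⊆ B ∧ A.Infinite

/-- The P-property: every sequence of elements of `𝓘` has a pseudo-union in `𝓘`, i.e. a member
`A` of `𝓘` with `S n \ A` finite for every `n`. -/
def HasPProperty {α : Type*} (𝓘 : Set (Set α)) : Prop :=
  ∀ S : ℕ → Set α, (∀ n, S n ∈ 𝓘) → ∃ A ∈ 𝓘, ∀ n, (S n \ A).Finite

/-- A family of subsets of `α`, viewed as a subset of `2^α` through characteristic functions.
Here `α → Bool` carries the product topology, with `Bool` discrete. -/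
def charFamily {α : Type*} (𝓢 : Set (Set α)) : Set (α → Bool) :=
  {f | {a | f a = true} ∈ 𝓢}

instance polishSpace_bool_cube {α : Type*} [Countable α] : PolishSpace (α → Bool) :=
  { toSecondCountableTopology := inferInstance
    toIsCompletelyMetrizableSpace := inferInstance }

/-- Coanalytic (boldface `Π¹₁`) subsets of a Polish space: complements of analytic sets. -/
def IsCoanalytic {Y : Type*} [TopologicalSpace Y] [PolishSpace Y] (B : Set Y) : Prop :=
  MeasureTheory.AnalyticSet Bᶜ

/-- A space is zero-dimensional if its clopen sets form a basis of the topology. -/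
def IsZeroDimensional (X : Type*) [TopologicalSpace X] : Prop :=
  TopologicalSpace.IsTopologicalBasis {U : Set X | IsClopen U}

/-- `Π¹₁`-completeness of a subset `A` of a Polish space `Y`: `A` is coanalytic, and every
coanalytic subset `B` of every zero-dimensional Polish space `X` is Wadge reducible to `A`, i.e.
`B` is the preimage of `A` under a continuous map `X → Y`. (Every Polish space is homeomorphic to
one whose underlying type lies in `Type`, so this quantifies over all zero-dimensional Polish
spaces.) -/
def IsCoanalyticComplete {Y : Type*} [TopologicalSpace Y] [PolishSpace Y] (A : Set Y) : Prop :=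
  IsCoanalytic A ∧
    ∀ (X : Type) [TopologicalSpace X] [PolishSpace X], IsZeroDimensional X →
      ∀ B : Set X, IsCoanalytic B → ∃ f : X → Y, Continuous f ∧ f ⁻¹' A = B

/-- The family of all `A ⊆ ω × ω` such that every product `X × Y` of infinite sets contains a
product `X' × Y'` of infinite sets `X' ⊆ X`, `Y' ⊆ Y` which is disjoint from `A`. -/
def idealZero : Set (Set (ℕ × ℕ)) :=
  {A | ∀ X Y : Set ℕ, X.Infinite → Y.Infinite →
    ∃ X' ⊆ X, ∃ Y' ⊆ Y, X'.Infinite ∧ Y'.Infinite ∧ A ∩ X' ×ˢ Y' = ∅}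

/-! By a Ramsey argument with a nonprincipal ultrafilter, a set lies outside the ideal iff it
contains a half graph in one of the two orientations (`notMem_idealZero_iff`). Containing one is a
projection of a closed condition, so the ideal is coanalytic. For hardness, write the complement of
`B` as `range g` with `g` continuous on Baire space, and send `x` to the prefix relation on the tree
of finite approximations to a preimage of `x`: a half graph there is an infinite branch, which `g`
maps to `x`. Tallness holds because an infinite set has a finite second projection or contains an
infinite set on which that projection is injective. The columns `{n} ×ˢ univ` refute the P-property.
-/

open Set Filter Topology Function

/-! ### Homogeneous sequences and half graphs -/

/-- A relation that holds for almost all pairs with respect to a nonprincipal ultrafilter holds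
along all increasing pairs of some subsequence. -/
theorem exists_strictMono_of_eventually_hyperfilter {r : ℕ → ℕ → Prop}
    (h : ∀ᶠ i in (hyperfilter ℕ : Filter ℕ), ∀ᶠ j in (hyperfilter ℕ : Filter ℕ), r i j) :
    ∃ φ : ℕ → ℕ, StrictMono φ ∧ ∀ i j, i < j → r (φ i) (φ j) := by
  obtain ⟨φ, -, hφ⟩ := exists_seq_of_forall_finset_exists
    (fun i => ∀ᶠ j in (hyperfilter ℕ : Filter ℕ), r i j) (fun i j => i < j ∧ r i j) (by
      intro s hs
      have hgt : ∀ i, ∀ᶠ j in (hyperfilter ℕ : Filter ℕ), i < j := fun i =>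
        Nat.hyperfilter_le_atTop (eventually_gt_atTop i)
      have hall : ∀ᶠ j in (hyperfilter ℕ : Filter ℕ), ∀ i ∈ s, i < j ∧ r i j :=
        (eventually_all_finset s).2 fun i hi => (hgt i).and (hs i hi)
      exact (h.and hall).exists)
  exact ⟨φ, fun i j hij => (hφ i j hij).1, fun i j hij => (hφ i j hij).2⟩

/-- `r` contains an infinite half graph: there are injective sequences `x`, `y` such that
`r (x i) (y j)` holds whenever `i < j`. -/
def HasHalfGraph (r : ℕ → ℕ → Prop) : Prop :=
  ∃ x y : ℕ → ℕ, Injective x ∧ Injective y ∧ ∀ i j, i < j → r (x i) (y j)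

theorem exists_lt_of_infinite_subset_range {x y : ℕ → ℕ} {X Y : Set ℕ} (hX : X.Infinite)
    (hY : Y.Infinite) (hXx : X ⊆ range x) (hYy : Y ⊆ range y) :
    ∃ i j, i < j ∧ x i ∈ X ∧ y j ∈ Y := by
  obtain ⟨a, ha⟩ := hX.nonempty
  obtain ⟨i, rfl⟩ := hXx ha
  obtain ⟨b, hb, hbi⟩ := hY.exists_notMem_finite ((finite_Iic i).image y)
  obtain ⟨j, rfl⟩ := hYy hb
  exact ⟨i, j, not_le.1 fun h => hbi ⟨j, h, rfl⟩, ha, hb⟩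

/-- A set is outside the ideal exactly when it contains an upper or a lower half graph. -/
theorem notMem_idealZero_iff {A : Set (ℕ × ℕ)} :
    A ∉ idealZero ↔
      HasHalfGraph (fun a b => (a, b) ∈ A) ∨ HasHalfGraph (fun b a => (a, b) ∈ A) := by
  constructor
  · intro hA
    simp only [idealZero, mem_ofPred_eq, not_forall] at hA
    obtain ⟨X, Y, hX, hY, hXY⟩ := hA
    obtain ⟨x, hx, hxX⟩ : ∃ x : ℕ → ℕ, Injective x ∧ ∀ n, x n ∈ X :=
      ⟨fun n => hX.natEmbedding X n, Subtype.val_injective.comp (hX.natEmbedding X).injective,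
        fun n => (hX.natEmbedding X n).2⟩
    obtain ⟨y, hy, hyY⟩ : ∃ y : ℕ → ℕ, Injective y ∧ ∀ n, y n ∈ Y :=
      ⟨fun n => hY.natEmbedding Y n, Subtype.val_injective.comp (hY.natEmbedding Y).injective,
        fun n => (hY.natEmbedding Y n).2⟩
    by_cases h₁ : ∀ᶠ i in (hyperfilter ℕ : Filter ℕ), ∀ᶠ j in (hyperfilter ℕ : Filter ℕ),
        (x i, y j) ∈ A
    · obtain ⟨φ, hφ, h⟩ := exists_strictMono_of_eventually_hyperfilter h₁
      exact .inl ⟨x ∘ φ, y ∘ φ, hx.comp hφ.injective, hy.comp hφ.injective, h⟩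
    by_cases h₂ : ∀ᶠ i in (hyperfilter ℕ : Filter ℕ), ∀ᶠ j in (hyperfilter ℕ : Filter ℕ),
        (x j, y i) ∈ A
    · obtain ⟨φ, hφ, h⟩ := exists_strictMono_of_eventually_hyperfilter h₂
      exact .inr ⟨y ∘ φ, x ∘ φ, hy.comp hφ.injective, hx.comp hφ.injective, h⟩
    -- An ultrafilter decides every set, so both failures become "almost all pairs avoid `A`".
    simp only [← Ultrafilter.eventually_not] at h₁ h₂
    obtain ⟨φ, hφ, h⟩ := exists_strictMono_of_eventually_hyperfilter
      ((h₁.and h₂).mono fun i hi => hi.1.and hi.2)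
    -- Nothing is known about equal indices; even ones for `x` and odd ones for `y` never coincide.
    have hinj₀ : Injective fun n => φ (2 * n) := hφ.injective.comp fun a b hab => by
      simpa using hab
    have hinj₁ : Injective fun n => φ (2 * n + 1) := hφ.injective.comp fun a b hab => by
      simpa using hab
    refine (hXY ⟨range fun n => x (φ (2 * n)), range_subset_iff.2 fun n => hxX _,
      range fun n => y (φ (2 * n + 1)), range_subset_iff.2 fun n => hyY _,
      infinite_range_of_injective (hx.comp hinj₀),
      infinite_range_of_injective (hy.comp hinj₁), ?_⟩).elim
    rw [eq_empty_iff_forall_notMem]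
    rintro ⟨_, _⟩ ⟨hA, ⟨m, rfl⟩, ⟨n, rfl⟩⟩
    rcases lt_or_gt_of_ne (show 2 * m ≠ 2 * n + 1 by omega) with hlt | hlt
    · exact (h _ _ hlt).1 hA
    · exact (h _ _ hlt).2 hA
  · rintro (⟨x, y, hx, hy, h⟩ | ⟨y, x, hy, hx, h⟩) hA <;>
      obtain ⟨X', hX', Y', hY', hX'i, hY'i, hdisj⟩ :=
        hA (range x) (range y) (infinite_range_of_injective hx) (infinite_range_of_injective hy)
    · obtain ⟨i, j, hij, hi, hj⟩ := exists_lt_of_infinite_subset_range hX'i hY'i hX' hY'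
      exact eq_empty_iff_forall_notMem.1 hdisj (x i, y j) ⟨h i j hij, hi, hj⟩
    · obtain ⟨i, j, hij, hi, hj⟩ := exists_lt_of_infinite_subset_range hY'i hX'i hY' hX'
      exact eq_empty_iff_forall_notMem.1 hdisj (x j, y i) ⟨h i j hij, hj, hi⟩

/-! ### Combinatorial properties of the ideal -/

theorem mem_idealZero_of_finite_image_fst {A : Set (ℕ × ℕ)} (hA : (Prod.fst '' A).Finite) :
    A ∈ idealZero := fun X Y hX hY =>
  ⟨X \ Prod.fst '' A, sdiff_subset, Y, Subset.rfl, hX.sdiff hA, hY,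
    eq_empty_iff_forall_notMem.2 fun _ hp => hp.2.1.2 (mem_image_of_mem _ hp.1)⟩

theorem mem_idealZero_of_finite_image_snd {A : Set (ℕ × ℕ)} (hA : (Prod.snd '' A).Finite) :
    A ∈ idealZero := fun X Y hX hY =>
  ⟨X, Subset.rfl, Y \ Prod.snd '' A, sdiff_subset, hX, hY.sdiff hA,
    eq_empty_iff_forall_notMem.2 fun _ hp => hp.2.2.2 (mem_image_of_mem _ hp.1)⟩

/-- A half graph of either orientation has two points with the same second coordinate. -/
theorem mem_idealZero_of_injOn_snd {A : Set (ℕ × ℕ)} (hA : InjOn Prod.snd A) :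
    A ∈ idealZero := by
  by_contra hA'
  rcases notMem_idealZero_iff.1 hA' with ⟨x, y, hx, -, h⟩ | ⟨y, x, -, hx, h⟩
  · have := hA (h 0 2 (by norm_num)) (h 1 2 (by norm_num)) rfl
    exact zero_ne_one (hx (congrArg Prod.fst this))
  · have := hA (h 0 1 (by norm_num)) (h 0 2 (by norm_num)) rfl
    exact absurd (hx (congrArg Prod.fst this)) (by norm_num)

theorem isSetIdeal_idealZero : IsSetIdeal idealZero where
  finite_mem _ hA := mem_idealZero_of_finite_image_fst (hA.image _)
  subset_mem A B hB hAB X Y hX hY := by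
    obtain ⟨X', hX', Y', hY', hX'i, hY'i, h⟩ := hB X Y hX hY
    exact ⟨X', hX', Y', hY', hX'i, hY'i,
      subset_empty_iff.1 (h ▸ inter_subset_inter_left _ hAB)⟩
  union_mem A B hA hB X Y hX hY := by
    obtain ⟨X₁, hX₁, Y₁, hY₁, hX₁i, hY₁i, h₁⟩ := hA X Y hX hY
    obtain ⟨X₂, hX₂, Y₂, hY₂, hX₂i, hY₂i, h₂⟩ := hB X₁ Y₁ hX₁i hY₁i
    refine ⟨X₂, hX₂.trans hX₁, Y₂, hY₂.trans hY₁, hX₂i, hY₂i, ?_⟩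
    rw [union_inter_distrib_right, h₂, union_empty]
    exact subset_empty_iff.1 (h₁ ▸ inter_subset_inter_right _ (prod_mono hX₂ hY₂))
  univ_notMem h := by
    obtain ⟨X, -, Y, -, hX, hY, h⟩ := h univ univ infinite_univ infinite_univ
    rw [univ_inter] at h
    exact (hX.nonempty.prod hY.nonempty).ne_empty h

theorem isTall_idealZero : IsTall idealZero := by
  intro B hB
  by_cases h : (Prod.snd '' B).Finite
  · exact ⟨B, mem_idealZero_of_finite_image_snd h, Subset.rfl, hB⟩
  · obtain ⟨A, hAB, hA⟩ := exists_subset_bijOn B Prod.snd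
    refine ⟨A, mem_idealZero_of_injOn_snd hA.injOn, hAB, fun hfin => h ?_⟩
    exact hA.image_eq ▸ hfin.image _

theorem not_hasPProperty_idealZero : ¬ HasPProperty idealZero := by
  intro h
  obtain ⟨A, hA, hfin⟩ := h (fun n => {n} ×ˢ univ) fun n =>
    mem_idealZero_of_finite_image_fst ((finite_singleton n).subset (by
      rintro _ ⟨p, hp, rfl⟩
      exact hp.1))
  obtain ⟨X, -, Y, -, hX, hY, hXY⟩ := hA univ univ infinite_univ infinite_univ
  obtain ⟨n, hn⟩ := hX.nonempty
  -- A rectangle `X ×ˢ Y` missing `A` leaves infinitely many points of column `n ∈ X` outside `A`.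
  refine (hY.image (f := Prod.mk n) (Prod.mk_right_injective n).injOn) ((hfin n).subset ?_)
  rintro _ ⟨m, hm, rfl⟩
  exact ⟨⟨rfl, mem_univ _⟩, fun hmA => eq_empty_iff_forall_notMem.1 hXY (n, m) ⟨hmA, hn, hm⟩⟩

/-! ### The ideal is coanalytic -/

theorem isClopen_setOf_apply_eq_true {Z ι : Type*} [TopologicalSpace Z] [TopologicalSpace ι]
    [DiscreteTopology ι] {F : Z → ι → Bool} {u : Z → ι} (hF : Continuous F)
    (hu : Continuous u) : IsClopen {z | F z (u z) = true} := by
  have hev : Continuous fun p : (ι → Bool) × ι => p.1 p.2 :=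
    continuous_prod_of_discrete_right.2 fun i => continuous_apply i
  exact (isClopen_discrete {true}).preimage (hev.comp (hF.prodMk hu))

theorem isClosed_setOf_injective {Z : Type*} [TopologicalSpace Z] {u : Z → ℕ → ℕ}
    (hu : Continuous u) : IsClosed {z | Injective (u z)} := by
  have : {z | Injective (u z)} = ⋂ (i) (j) (_ : i ≠ j), {z | u z i = u z j}ᶜ := by
    ext z
    simp only [mem_ofPred_eq, mem_iInter, mem_compl_iff]
    exact ⟨fun h i j hij he => hij (h he), fun h i j he => by_contra fun hij => h i j hij he⟩
  rw [this]
  refine isClosed_iInter fun i => isClosed_iInter fun j => isClosed_iInter fun _ => ?_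
  have hc : Continuous fun z => (u z i, u z j) :=
    ((continuous_apply i).comp hu).prodMk ((continuous_apply j).comp hu)
  exact ((isClopen_discrete {p : ℕ × ℕ | p.1 = p.2}).preimage hc).compl.isClosed

theorem analyticSet_setOf_hasHalfGraph {Y : Type*} [TopologicalSpace Y] [PolishSpace Y]
    {F : Y → ℕ × ℕ → Bool} (hF : Continuous F) :
    MeasureTheory.AnalyticSet {f | HasHalfGraph fun a b => F f (a, b) = true} := by
  set S : Set (Y × (ℕ → ℕ) × (ℕ → ℕ)) := {p | Injective p.2.1} ∩ ({p | Injective p.2.2} ∩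
    ⋂ (i) (j) (_ : i < j), {p | F p.1 (p.2.1 i, p.2.2 j) = true}) with hS
  have hclosed : IsClosed S := by
    refine (isClosed_setOf_injective (by fun_prop)).inter
      ((isClosed_setOf_injective (by fun_prop)).inter ?_)
    refine isClosed_iInter fun i => isClosed_iInter fun j => isClosed_iInter fun _ => ?_
    exact (isClopen_setOf_apply_eq_true (F := fun p : Y × (ℕ → ℕ) × (ℕ → ℕ) => F p.1)
      (u := fun p => (p.2.1 i, p.2.2 j)) (hF.comp continuous_fst) (by fun_prop)).isClosed
  convert hclosed.analyticSet.image_of_continuous (continuous_fst (X := Y)) using 1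
  ext f
  simp only [hS, HasHalfGraph, mem_image, mem_inter_iff, mem_ofPred_eq, mem_iInter, Prod.exists,
    exists_and_right, exists_eq_right]

theorem isCoanalytic_charFamily_idealZero : IsCoanalytic (charFamily idealZero) := by
  have hswap : Continuous fun (f : ℕ × ℕ → Bool) p => f (Prod.swap p) := by fun_prop
  have h : ∀ b : Bool, MeasureTheory.AnalyticSet (cond b
      {f : ℕ × ℕ → Bool | HasHalfGraph fun a b => f (a, b) = true}
      {f : ℕ × ℕ → Bool | HasHalfGraph fun a b => f (b, a) = true}) := by
    rintro (_ | _)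
    · exact analyticSet_setOf_hasHalfGraph hswap
    · exact analyticSet_setOf_hasHalfGraph continuous_id
  rw [IsCoanalytic]
  convert MeasureTheory.AnalyticSet.iUnion h using 1
  ext f
  simp only [mem_compl_iff, charFamily, mem_ofPred_eq, notMem_idealZero_iff, mem_iUnion,
    Bool.exists_bool, cond_true, cond_false, or_comm]

/-! ### Hardness -/

/-- The finite sequence `s` is an initial segment of the infinite sequence `z`. -/
def IsInitialSegment (s : List ℕ) (z : ℕ → ℕ) : Prop :=
  ∀ k < s.length, s[k]? = some (z k)

/-- The pairs of codes of nodes `s`, `t` of `T` such that `s` is an initial segment of `t`. -/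
def prefixPairs (T : Set (List ℕ)) : Set (ℕ × ℕ) :=
  {p | Denumerable.ofNat (List ℕ) p.1 ∈ T ∧ Denumerable.ofNat (List ℕ) p.2 ∈ T ∧
    Denumerable.ofNat (List ℕ) p.1 <+: Denumerable.ofNat (List ℕ) p.2}

/-- Lists with a common extension are comparable, so distinct ones have distinct lengths; the
lengths tend to infinity and the lists glue to one sequence. -/
theorem exists_initialSegments_of_prefix {x : ℕ → List ℕ} (hx : Injective x)
    (hcomp : ∀ i j, i < j → ∃ t, x i <+: t ∧ x j <+: t) :
    ∃ z : ℕ → ℕ, (∀ i, IsInitialSegment (x i) z) ∧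
      Tendsto (fun i => (x i).length) atTop atTop := by
  have hcomp' : ∀ i j, x i <+: x j ∨ x j <+: x i := by
    intro i j
    rcases lt_trichotomy i j with h | rfl | h
    · obtain ⟨t, h₁, h₂⟩ := hcomp i j h
      exact List.prefix_or_prefix_of_prefix h₁ h₂
    · exact .inl (List.prefix_rfl)
    · obtain ⟨t, h₁, h₂⟩ := hcomp j i h
      exact List.prefix_or_prefix_of_prefix h₂ h₁
  have hlen : Injective fun i => (x i).length := by
    intro i j hij
    rcases hcomp' i j with h | h
    · exact hx (h.eq_of_length hij)
    · exact hx (h.eq_of_length hij.symm).symm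
  have htend := hlen.nat_tendsto_atTop
  choose m hm using fun n => (htend.eventually (eventually_gt_atTop n)).exists
  refine ⟨fun n => (x (m n))[n]'(hm n), fun i k hk => ?_, htend⟩
  rw [← List.getElem?_eq_getElem (hm k)]
  rcases hcomp' i (m k) with h | h
  · rw [List.getElem?_eq_getElem hk, h.getElem hk, List.getElem?_eq_getElem]
  · rw [List.getElem?_eq_getElem (hm k), h.getElem (hm k), List.getElem?_eq_getElem]

/-- A set of nodes spans a half graph of prefixes exactly when it has arbitrarily long nodes along
some infinite sequence. -/
theorem prefixPairs_notMem_idealZero_iff {T : Set (List ℕ)} :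
    prefixPairs T ∉ idealZero ↔ ∃ (x : ℕ → List ℕ) (z : ℕ → ℕ), (∀ i, x i ∈ T) ∧
      (∀ i, IsInitialSegment (x i) z) ∧ Tendsto (fun i => (x i).length) atTop atTop := by
  have hinj : Injective (Denumerable.ofNat (List ℕ)) := (Denumerable.eqv (List ℕ)).symm.injective
  rw [notMem_idealZero_iff]
  constructor
  · rintro (⟨x, y, hx, -, h⟩ | ⟨y, x, -, hx, h⟩)
    · obtain ⟨z, hz, hlen⟩ := exists_initialSegments_of_prefix (hinj.comp hx) fun i j hij =>
        ⟨_, (h i (j + 1) (by omega)).2.2, (h j (j + 1) (by omega)).2.2⟩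
      exact ⟨_, z, fun i => (h i (i + 1) (by omega)).1, hz, hlen⟩
    -- In this orientation `y 0` would code a list with infinitely many prefixes.
    · refine absurd ?_ (infinite_range_of_injective
        ((hinj.comp hx).comp (add_left_injective 1))).not_finite
      refine (List.finite_toSet (Denumerable.ofNat (List ℕ) (y 0)).inits).subset ?_
      rintro _ ⟨i, rfl⟩
      exact (List.mem_inits _ _).2 (h 0 (i + 1) (by omega)).2.2
  · rintro ⟨x, z, hxT, hxz, hlen⟩
    obtain ⟨φ, -, hφ⟩ := strictMono_subseq_of_tendsto_atTop hlen
    have hx : Injective fun i => Encodable.encode (x (φ i)) := fun i j hij =>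
      hφ.injective (congrArg List.length (Encodable.encode_injective hij))
    refine .inl ⟨_, _, hx, hx, fun i j hij => ?_⟩
    simp only [prefixPairs, mem_ofPred_eq, Denumerable.ofNat_encode]
    refine ⟨hxT _, hxT _, List.prefix_iff_getElem?.2 fun k hk => ?_⟩
    rw [hxz _ k (hk.trans (hφ hij)), ← hxz _ k hk, List.getElem?_eq_getElem]

theorem eventually_mem_iff_of_isClopen {X : Type*} [TopologicalSpace X] {U : Set X}
    (hU : IsClopen U) (x : X) : ∀ᶠ y in 𝓝 x, (y ∈ U ↔ x ∈ U) := by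
  by_cases hx : x ∈ U
  · filter_upwards [hU.isOpen.mem_nhds hx] with y hy
    exact iff_of_true hy hx
  · filter_upwards [hU.compl.isOpen.mem_nhds hx] with y hy
    exact iff_of_false hy hx

theorem IsZeroDimensional.exists_seq_isClopen_separating {X : Type*} [TopologicalSpace X]
    [SecondCountableTopology X] [T0Space X] (hX : IsZeroDimensional X) :
    ∃ U : ℕ → Set X, (∀ k, IsClopen (U k)) ∧ ∀ x y, (∀ k, x ∈ U k ↔ y ∈ U k) → x = y := by
  obtain ⟨s, hs, hsc, hsb⟩ := TopologicalSpace.IsTopologicalBasis.exists_countable hX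
  -- Adding `∅` makes the family nonempty, hence enumerable by `ℕ`.
  obtain ⟨U, hU⟩ := (hsc.insert ∅).exists_eq_range (insert_nonempty _ _)
  refine ⟨U, fun k => ?_, fun x y hxy => ?_⟩
  · rcases (hU ▸ mem_range_self k : U k ∈ insert ∅ s) with h | h
    · exact h ▸ isClopen_empty
    · exact hs h
  · refine hsb.eq_iff.2 fun V hV => ?_
    obtain ⟨k, rfl⟩ : V ∈ range U := hU ▸ mem_insert_of_mem _ hV
    exact hxy k

/-- The tree of attempts to find a preimage of `x` under `g`, up to the precision given by
the sets `U k`. -/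
def approxTree {X : Type*} (g : (ℕ → ℕ) → X) (U : ℕ → Set X) (x : X) : Set (List ℕ) :=
  {s | ∃ w, IsInitialSegment s w ∧ ∀ k < s.length, (g w ∈ U k ↔ x ∈ U k)}

/-- The witnesses of ever longer nodes along `z` converge to `z`, so by continuity `g z` agrees with
`x` on every clopen `U k`. -/
theorem prefixPairs_approxTree_notMem_iff {X : Type*} [TopologicalSpace X] {g : (ℕ → ℕ) → X}
    (hg : Continuous g) {U : ℕ → Set X} (hU : ∀ k, IsClopen (U k))
    (hsep : ∀ x y, (∀ k, x ∈ U k ↔ y ∈ U k) → x = y) (x : X) :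
    prefixPairs (approxTree g U x) ∉ idealZero ↔ x ∈ range g := by
  rw [prefixPairs_notMem_idealZero_iff]
  constructor
  · rintro ⟨s, z, hs, hz, hlen⟩
    choose w hw hwU using hs
    have hwz : Tendsto w atTop (𝓝 z) := tendsto_pi_nhds.2 fun k => by
      refine tendsto_const_nhds.congr' ?_
      filter_upwards [hlen.eventually (eventually_gt_atTop k)] with i hi
      exact Option.some_injective _ ((hz i k hi).symm.trans (hw i k hi))
    refine ⟨z, hsep _ _ fun k => ?_⟩
    obtain ⟨i, hi, hik⟩ := (((hg.tendsto z).comp hwz |>.eventually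
      (eventually_mem_iff_of_isClopen (hU k) (g z))).and
        (hlen.eventually (eventually_gt_atTop k))).exists
    exact hi.symm.trans (hwU i k hik)
  · rintro ⟨z, rfl⟩
    have hseg : ∀ n, IsInitialSegment ((List.range n).map z) z := fun n k hk => by
      have hk' : k < n := by simpa using hk
      simp [hk']
    refine ⟨fun n => (List.range n).map z, z, fun n => ⟨z, hseg n, fun _ _ => Iff.rfl⟩, hseg, ?_⟩
    simp only [List.length_map, List.length_range]
    exact tendsto_id

-- Whether a node belongs to the tree depends on only finitely many of the conditions `x ∈ U k`, so
-- it is locally constant in `x`.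
open scoped Classical in
theorem continuous_decide_mem_prefixPairs_approxTree {X : Type*} [TopologicalSpace X]
    (g : (ℕ → ℕ) → X) {U : ℕ → Set X} (hU : ∀ k, IsClopen (U k)) :
    Continuous fun x p => decide (p ∈ prefixPairs (approxTree g U x)) := by
  have hT : ∀ (s : List ℕ) (x : X), ∀ᶠ y in 𝓝 x,
      (s ∈ approxTree g U y ↔ s ∈ approxTree g U x) := fun s x => by
    have : ∀ᶠ y in 𝓝 x, ∀ k ∈ Finset.range s.length, (y ∈ U k ↔ x ∈ U k) :=
      (eventually_all_finset _).2 fun k _ => eventually_mem_iff_of_isClopen (hU k) x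
    filter_upwards [this] with y hy
    refine exists_congr fun w => and_congr_right fun _ => forall₂_congr fun k hk => ?_
    rw [hy k (Finset.mem_range.2 hk)]
  refine continuous_pi fun p => IsLocallyConstant.continuous
    ((IsLocallyConstant.iff_eventually_eq _).2 fun x => ?_)
  filter_upwards [hT (Denumerable.ofNat (List ℕ) p.1) x, hT (Denumerable.ofNat (List ℕ) p.2) x]
    with y h₁ h₂
  exact decide_eq_decide.2 (and_congr h₁ (and_congr_left fun _ => h₂))

theorem isCoanalyticComplete_charFamily_idealZero :
    IsCoanalyticComplete (charFamily idealZero) := by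
  classical
  refine ⟨isCoanalytic_charFamily_idealZero, fun X _ _ hX B hB => ?_⟩
  rw [IsCoanalytic, MeasureTheory.AnalyticSet] at hB
  rcases hB with hB | ⟨g, hg, hgB⟩
  · refine ⟨fun _ _ => false, continuous_const, ?_⟩
    rw [compl_empty_iff.1 hB, eq_univ_iff_forall]
    intro x
    simpa [charFamily] using isSetIdeal_idealZero.finite_mem ∅ finite_empty
  · obtain ⟨U, hU, hsep⟩ := hX.exists_seq_isClopen_separating
    refine ⟨_, continuous_decide_mem_prefixPairs_approxTree g hU, ?_⟩
    ext x
    have := prefixPairs_approxTree_notMem_iff hg hU hsep x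
    rw [hgB, mem_compl_iff, not_iff_not] at this
    simpa [charFamily] using this

theorem theorem3p4 :
    IsSetIdeal idealZero ∧
      IsCoanalyticComplete (charFamily idealZero) ∧
      IsTall idealZero ∧
      ¬ HasPProperty idealZero :=
  ⟨isSetIdeal_idealZero, isCoanalyticComplete_charFamily_idealZero, isTall_idealZero,
    not_hasPProperty_idealZero⟩
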